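/- Let $n\ge 0$ be an integer, $\Omega\subset\mathbb R^n$ compact, $\mathcal M(\Omega)$ the space of finite signed (real-valued) Radon measures on $\Omega$ with total variation norm $\|\mu\|_{\mathcal M}=|\mu|(\Omega)$, and $\langle\varphi,\mu\rangle=\int_\Omega\varphi\,d\mu$ its pairing with the predual $C(\Omega)=C_c(\Omega)$ of real continuous functions on $\Omega$. Weak-$*$ convergence $\mu^k\rightharpoonup^*\mu$ means $\langle\varphi,\mu^k\rangle\to\langle\varphi,\mu\rangle$ for every $\varphi\in C(\Omega)$. Let $\rho\in C_c(\mathbb R^n)$ be a real-valued function, not identically zero, which is symmetric, $\rho(-x)=\rho(x)$ for all $x$, and whose Fourier transform $\hat\rho(\xi)=\int_{\mathbb R^n}\rho(x)e^{-2\pi i\langle x,\xi\rangle}\,dx$ is nonnegative for all $\xi\in\mathbb R^n$. Let $\mathcal D:\mathcal M(\Omega)\to C(\Omega)$ be the bounded linear operator $$(\mathcal D\mu)(x)=(\rho*\mu)(x)=\int_\Omega\rho(x-y)\,d\mu(y)\qquad(x\in\Omega),$$ and write $\|\mu\|_{\mathcal D}=\sqrt{\langle\mathcal D\mu,\mu\rangle}$.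 Then: (i) $\mathcal D$ is self-adjoint and positive semi-definite: $\langle\mathcal D\mu,\nu\rangle=\langle\mathcal D\nu,\mu\rangle$ and $\langle\mathcal D\mu,\mu\rangle\ge 0$ for all $\mu,\nu\in\mathcal M(\Omega)$. (ii) $\mathcal D$ is strictly positive definite on discrete measures: $\langle\mathcal D\mu,\mu\rangle>0$ for every nonzero $\mu$ of the form $\mu=\sum_{k=1}^m\alpha_k\delta_{x_k}$ with $m\in\mathbb N$, $\alpha_k\in\mathbb R$, $x_k\in\Omega$. Assume further that $\rho=\rho^{1/2}*\rho^{1/2}$ for a real-valued function $\rho^{1/2}\in L^2(\mathbb R^n)\cap C_0(\mathbb R^n)$, where $C_0(\mathbb R^n)$ denotes the continuous functions vanishing at infinity. Then, for every sequence $(\mu^k)_{k\in\mathbb N}$ in $\mathcal M(\Omega)$ and every $\mu\in\mathcal M(\Omega)$: (iii) if $\rho^{1/2}$ has compact support, then $\mu^k\rightharpoonup^*\mu$ implies $\|\mu^k-\mu\|_{\mathcal D}\to0$; (iv) if the set of translates $\{x\mapsto\rho^{1/2}(x-y)\mid y\in\Omega\}$ is fundamental in $C(\Omega)$, that is, its linear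 span is dense in $C(\Omega)$ for the supremum norm, and $\sup_k\|\mu^k\|_{\mathcal M}<\infty$, then $\|\mu^k-\mu\|_{\mathcal D}\to0$ implies $\mu^k\rightharpoonup^*\mu$. -/

import Mathlib

open MeasureTheory TopologicalSpace Filter Topology
open scoped CompactlySupported ZeroAtInfty FourierTransform Convolution

noncomputable section

/-- `ℝⁿ` with its Euclidean norm and Lebesgue measure. -/
abbrev Rn (n : ℕ) : Type := EuclideanSpace ℝ (Fin n)

/-! ### Radon measures on a compact set -/

/-- `ℳ(Ω)`: the finite real-valued (signed) Borel measures on the compact set `Ω ⊆ ℝⁿ`.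
Every such measure is Radon, since `Ω` is a compact metric space. -/
abbrev RadonMeasure {n : ℕ} (Ω : Compacts (Rn n)) : Type := SignedMeasure Ω

variable {n : ℕ} {Ω : Compacts (Rn n)}

/-- The Radon norm `|μ|(Ω)`. -/
def radonNorm (μ : RadonMeasure Ω) : ℝ := μ.totalVariation.real Set.univ

/-- The dual pairing `⟨φ, μ⟩ = ∫_Ω φ dμ` between `C(Ω) = C_c(Ω)` and `ℳ(Ω)`. -/
def dualPairing (φ : C(Ω, ℝ)) (μ : RadonMeasure Ω) : ℝ :=
  VectorMeasure.integral μ (fun x => φ x) (ContinuousLinearMap.lsmul ℝ ℝ)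

/-- Weak-* convergence of a sequence in `ℳ(Ω)`, the dual of `C(Ω)`. -/
def WeakStarTendsto (μs : ℕ → RadonMeasure Ω) (μ : RadonMeasure Ω) : Prop :=
  ∀ φ : C(Ω, ℝ), Tendsto (fun k => dualPairing φ (μs k)) atTop (𝓝 (dualPairing φ μ))

/-- The discrete measures `∑ αₖ δ_{xₖ}` (finite sums, real weights, `xₖ ∈ Ω`). -/
def discreteMeasures (Ω : Compacts (Rn n)) : Set (RadonMeasure Ω) :=
  {μ | ∃ (m : ℕ) (α : Fin m → ℝ) (x : Fin m → Ω),
    μ = ∑ k, α k • (VectorMeasure.dirac (x k) (1 : ℝ) : RadonMeasure Ω)}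

/-! ### Operators from `ℳ(Ω)` to its predual `C(Ω)` -/

/-- `⟨D μ, ν⟩ = ⟨D ν, μ⟩` for all `μ, ν`. -/
def IsPreSelfAdjoint (D : RadonMeasure Ω →ₗ[ℝ] C(Ω, ℝ)) : Prop :=
  ∀ μ ν : RadonMeasure Ω, dualPairing (D μ) ν = dualPairing (D ν) μ

/-- `⟨D μ, μ⟩ ≥ 0` for all `μ`. -/
def IsPrePosSemidef (D : RadonMeasure Ω →ₗ[ℝ] C(Ω, ℝ)) : Prop :=
  ∀ μ : RadonMeasure Ω, 0 ≤ dualPairing (D μ) μ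

/-- `⟨D μ, μ⟩ > 0` for all nonzero `μ ∈ Z`. -/
def IsPrePosDefOn (D : RadonMeasure Ω →ₗ[ℝ] C(Ω, ℝ)) (Z : Set (RadonMeasure Ω)) : Prop :=
  ∀ μ ∈ Z, μ ≠ 0 → 0 < dualPairing (D μ) μ

/-- The seminorm `‖μ‖_D = √⟨D μ, μ⟩`. -/
def opSeminorm (D : RadonMeasure Ω →ₗ[ℝ] C(Ω, ℝ)) (μ : RadonMeasure Ω) : ℝ :=
  Real.sqrt (dualPairing (D μ) μ)

/-! ### The convolution operator -/

instance isFiniteMeasure_variation_radonMeasure (μ : RadonMeasure Ω) :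
    IsFiniteMeasure (VectorMeasure.variation μ) := by
  rw [← SignedMeasure.totalVariation_eq_variation, SignedMeasure.totalVariation]
  infer_instance

theorem integrable_radonMeasure (φ : C(Ω, ℝ)) (μ : RadonMeasure Ω) :
    VectorMeasure.Integrable μ (fun x => φ x) :=
  φ.continuous.integrable_of_hasCompactSupport (HasCompactSupport.of_compactSpace _)

/-- The function `y ↦ ρ (x - y)` on `Ω`. -/
def reflectedTranslate (ρ : C_c(Rn n, ℝ)) (x : Rn n) : C(Ω, ℝ) where
  toFun y := ρ (x - y)
  continuous_toFun := ρ.continuous.comp (by fun_prop)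

theorem exists_abs_le_kernel (ρ : C_c(Rn n, ℝ)) :
    ∃ C : ℝ, 0 ≤ C ∧ ∀ x, |ρ x| ≤ C := by
  obtain ⟨C, hC⟩ := ρ.hasCompactSupport.exists_bound_of_continuous ρ.continuous
  exact ⟨C, (norm_nonneg _).trans (hC 0), hC⟩

/-- The convolution `(ρ * μ)(x) = ∫_Ω ρ (x - y) dμ(y)`. -/
def measureConvolution (ρ : C_c(Rn n, ℝ)) (μ : RadonMeasure Ω) (x : Rn n) : ℝ :=
  VectorMeasure.integral μ (fun y : Ω => ρ (x - y)) (ContinuousLinearMap.lsmul ℝ ℝ)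

theorem continuous_measureConvolution (ρ : C_c(Rn n, ℝ)) (μ : RadonMeasure Ω) :
    Continuous (measureConvolution ρ μ) := by
  obtain ⟨C, -, hC⟩ := exists_abs_le_kernel ρ
  refine VectorMeasure.continuous_of_dominated (bound := fun _ => C) ?_ ?_ ?_ ?_
  · intro x
    exact (integrable_radonMeasure (reflectedTranslate ρ x) μ).aestronglyMeasurable
  · intro x
    exact Eventually.of_forall fun y => hC _
  · exact integrable_const C
  · exact Eventually.of_forall fun y => ρ.continuous.comp (by fun_prop)

/-- The operator `𝒟 : ℳ(Ω) → C(Ω)`, `𝒟 μ = ρ * μ` (restricted to `Ω`). -/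
def convolutionOperator (Ω : Compacts (Rn n)) (ρ : C_c(Rn n, ℝ)) :
    RadonMeasure Ω →ₗ[ℝ] C(Ω, ℝ) where
  toFun μ := ⟨fun x : Ω => measureConvolution ρ μ x,
    (continuous_measureConvolution ρ μ).comp continuous_subtype_val⟩
  map_add' μ ν := by
    ext x
    exact VectorMeasure.integral_add_vectorMeasure
      (integrable_radonMeasure (reflectedTranslate ρ x) μ)
      (integrable_radonMeasure (reflectedTranslate ρ x) ν)
  map_smul' c μ := by
    ext x
    exact VectorMeasure.integral_smul_vectorMeasure _ c

/-- `𝒟` is a bounded operator with respect to the Radon norm and the supremum norm. -/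
theorem convolutionOperator_bounded (Ω : Compacts (Rn n)) (ρ : C_c(Rn n, ℝ)) :
    ∃ C : ℝ, ∀ μ : RadonMeasure Ω, ‖convolutionOperator Ω ρ μ‖ ≤ C * radonNorm μ := by
  obtain ⟨C, hC0, hC⟩ := exists_abs_le_kernel ρ
  refine ⟨C, fun μ => ?_⟩
  have h0 : 0 ≤ C * radonNorm μ := mul_nonneg hC0 measureReal_nonneg
  refine (ContinuousMap.norm_le _ h0).2 fun x => ?_
  have h1 : ‖measureConvolution ρ μ x‖ ≤ _ := VectorMeasure.norm_integral_le_integral_norm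
  refine h1.trans ?_
  have h2 : ‖(ContinuousLinearMap.lsmul ℝ ℝ : ℝ →L[ℝ] ℝ →L[ℝ] ℝ)‖ ≤ 1 :=
    ContinuousLinearMap.opNorm_lsmul_le
  have h3 : ∫ y : Ω, ‖ρ ((x : Rn n) - y)‖ ∂(VectorMeasure.variation μ) ≤ C * radonNorm μ := by
    calc _ ≤ ∫ _ : Ω, C ∂(VectorMeasure.variation μ) := by
          refine integral_mono
            (integrable_radonMeasure (reflectedTranslate ρ x) μ).norm (integrable_const C) ?_
          exact fun y => hC _
      _ = C * radonNorm μ := by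
          simp [radonNorm, SignedMeasure.totalVariation_eq_variation, mul_comm]
  calc _ ≤ 1 * (C * radonNorm μ) := by
        refine mul_le_mul h2 h3 (integral_nonneg fun _ => norm_nonneg _) zero_le_one
    _ = _ := one_mul _

/-! ### Kernels -/

/-- `ρ(-x) = ρ(x)` for all `x`. -/
def IsSymmetricKernel (ρ : C_c(Rn n, ℝ)) : Prop := ∀ x, ρ (-x) = ρ x

/-- The Fourier transform `∫ ρ(x) exp(-2πi⟨x, ξ⟩) dx` is real and nonnegative for every `ξ`. -/
def IsPosSemidefKernel (ρ : C_c(Rn n, ℝ)) : Prop :=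
  ∀ ξ : Rn n, (𝓕 (fun x : Rn n => (ρ x : ℂ)) ξ).im = 0 ∧
    0 ≤ (𝓕 (fun x : Rn n => (ρ x : ℂ)) ξ).re

/-- The autoconvolution `(u * u)(x) = ∫ u(t) u(x - t) dt`. -/
def autoconvolution (u : Rn n → ℝ) : Rn n → ℝ :=
  u ⋆[ContinuousLinearMap.mul ℝ ℝ, volume] u

/-- `V_u(Ω)`: the functions `x ↦ u (x - y)` on `Ω`, for `y ∈ Ω`. -/
def translates (Ω : Compacts (Rn n)) (u : C₀(Rn n, ℝ)) : Set C(Ω, ℝ) :=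
  {φ | ∃ y : Ω, ∀ x : Ω, φ x = u ((x : Rn n) - y)}

/-- A subset of a normed space is fundamental if its linear span is dense. -/
def IsFundamental {X : Type*} [NormedAddCommGroup X] [NormedSpace ℝ X] (V : Set X) : Prop :=
  Dense (Submodule.span ℝ V : Set X)

end

/-!
The energy `⟨ρ * μ, μ⟩` is rewritten in two ways as the squared `L²` norm of a linear transform of
the measure `μ`. Both come from one Fubini argument, `integral_integral_kernel_eq_integral_sq`: if
a kernel factors as `K x y = ∫ g(s, x) conj (g(s, y)) ds`, its energy is `∫ |∫ g(s, x) dμ(x)|² ds`.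
Signed measures enter through their polar decomposition `dμ = h d|μ|` (`exists_sign_density`).

*Spectral form.* A continuous integrable function with nonnegative Fourier transform has an
integrable Fourier transform (`integrable_fourier_of_nonneg`), so Fourier inversion factors
`ρ (x - y)` with the features `√ρ̂(ξ) exp (2πi⟨x, ξ⟩)`. Hence `⟨ρ * μ, μ⟩ = ∫ ρ̂ |μ̂|²`, which is
nonnegative. If it vanishes for a discrete `μ`, the trigonometric polynomial `μ̂` vanishes on the
nonempty open set `{ρ̂ > 0}`, hence everywhere by analyticity, and `μ = 0` because a measure is
determined by its characteristic function.

*From weak-* convergence to the seminorm.* The functionals of a weak-* null sequence are bounded by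
the uniform boundedness principle, hence equicontinuous, and so tend to zero uniformly on the
compact set of translates of `ρ` by points of `Ω`. Thus `ρ * νₖ → 0` uniformly, and
`⟨ρ * νₖ, νₖ⟩ → 0`.

*From the seminorm to weak-* convergence.* The square root `u` is not assumed to be even, but it is:
the convolution theorem on `L²` gives `û² = ρ̂ ≥ 0`, so `|û|² = û²`, and Plancherel's theorem yields
`‖u‖² = ρ(0) = ∫ u(t) u(-t) dt`, that is, `u` equals its reflection
(`even_of_autoconvolution_eq`). Consequently `⟨ρ * ν, ν⟩ = ‖u * ν‖²`. For bounded `νₖ` the functions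
`u * νₖ` share a modulus of continuity, so their convergence to zero in `L²` is pointwise; this is
convergence of `νₖ` tested on the translates of `u`, and density of their span concludes.
-/

/-! ### The pairing of signed measures with continuous functions -/

section Pairing

variable {n : ℕ} {Ω : Compacts (Rn n)}

theorem dualPairing_eq_integral_posPart_sub_negPart (φ : C(Ω, ℝ)) (μ : RadonMeasure Ω) :
    dualPairing φ μ = ∫ x, φ x ∂μ.toJordanDecomposition.posPart -
      ∫ x, φ x ∂μ.toJordanDecomposition.negPart := by
  have h := μ.toSignedMeasure_toJordanDecomposition
  rw [JordanDecomposition.toSignedMeasure] at h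
  rw [dualPairing]
  nth_rw 1 [← h]
  rw [VectorMeasure.integral_sub_vectorMeasure (integrable_radonMeasure φ _)
    (integrable_radonMeasure φ _)]
  -- `integral_toSignedMeasure` is stated for the flipped scalar multiplication
  have hflip : (ContinuousLinearMap.lsmul ℝ ℝ : ℝ →L[ℝ] ℝ →L[ℝ] ℝ) =
      (ContinuousLinearMap.lsmul ℝ ℝ).flip := by
    ext
    simp
  rw [hflip, VectorMeasure.integral_toSignedMeasure, VectorMeasure.integral_toSignedMeasure]

/-- Polar decomposition of a signed measure: `dμ = h d|μ|` with a sign function `h`. -/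
theorem exists_sign_density (μ : RadonMeasure Ω) :
    ∃ h : Ω → ℝ, Measurable h ∧ (∀ x, |h x| ≤ 1) ∧
      ∀ φ : C(Ω, ℝ), dualPairing φ μ = ∫ x, φ x * h x ∂μ.totalVariation := by
  classical
  obtain ⟨S, hS, hpos, hneg⟩ := μ.toJordanDecomposition.mutuallySingular
  have hmeas : Measurable fun x : Ω => if x ∈ S then (-1 : ℝ) else 1 :=
    Measurable.ite hS measurable_const measurable_const
  refine ⟨fun x => if x ∈ S then -1 else 1, hmeas, ?_, ?_⟩
  · intro x
    dsimp only
    split_ifs <;> simp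
  · intro φ
    have hint : ∀ m : Measure Ω, IsFiniteMeasure m →
        Integrable (fun x => φ x * (if x ∈ S then (-1 : ℝ) else 1)) m := by
      intro m _
      refine Integrable.of_bound (C := ‖φ‖) ?_ ?_
      · exact (φ.continuous.measurable.mul hmeas).aestronglyMeasurable
      · refine Eventually.of_forall fun x => ?_
        have := φ.norm_coe_le_norm x
        split_ifs <;> simpa using this
    rw [dualPairing_eq_integral_posPart_sub_negPart, SignedMeasure.totalVariation,
      integral_add_measure (hint _ inferInstance) (hint _ inferInstance), sub_eq_add_neg,
      ← integral_neg]
    congr 1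
    · refine integral_congr_ae ?_
      have : ∀ᵐ x ∂μ.toJordanDecomposition.posPart, x ∉ S := measure_eq_zero_iff_ae_notMem.1 hpos
      filter_upwards [this] with x hx
      simp [hx]
    · refine integral_congr_ae ?_
      have : ∀ᵐ x ∂μ.toJordanDecomposition.negPart, x ∉ Sᶜ :=
        measure_eq_zero_iff_ae_notMem.1 hneg
      filter_upwards [this] with x hx
      simp [not_not.1 hx]

theorem abs_integral_mul_le_of_abs_le {X : Type*} [MeasurableSpace X] {m : Measure X}
    [IsFiniteMeasure m] {φ h : X → ℝ} (hh : ∀ x, |h x| ≤ 1) {C : ℝ} (hφ : ∀ x, |φ x| ≤ C) :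
    |∫ x, φ x * h x ∂m| ≤ C * m.real Set.univ := by
  rw [← Real.norm_eq_abs]
  refine norm_integral_le_of_norm_le_const (Eventually.of_forall fun x => ?_)
  rw [norm_mul, Real.norm_eq_abs, Real.norm_eq_abs]
  exact (mul_le_of_le_one_right (abs_nonneg _) (hh x)).trans (hφ x)

theorem abs_dualPairing_le (φ : C(Ω, ℝ)) (μ : RadonMeasure Ω) :
    |dualPairing φ μ| ≤ ‖φ‖ * radonNorm μ := by
  obtain ⟨h, -, hh, hφ⟩ := exists_sign_density μ
  rw [hφ]
  exact abs_integral_mul_le_of_abs_le hh fun x => φ.norm_coe_le_norm x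

/-- The functional `φ ↦ ⟨φ, μ⟩` on `C(Ω)`. -/
noncomputable def pairingCLM (μ : RadonMeasure Ω) : C(Ω, ℝ) →L[ℝ] ℝ :=
  LinearMap.mkContinuous
    { toFun := fun φ => dualPairing φ μ
      map_add' := fun φ ψ => VectorMeasure.integral_fun_add (integrable_radonMeasure φ μ)
        (integrable_radonMeasure ψ μ)
      map_smul' := fun c φ => VectorMeasure.integral_fun_smul μ _ c (fun x => φ x) }
    (radonNorm μ) fun φ => by
      rw [mul_comm]; exact abs_dualPairing_le φ μ

@[simp]
theorem pairingCLM_apply (μ : RadonMeasure Ω) (φ : C(Ω, ℝ)) :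
    pairingCLM μ φ = dualPairing φ μ := rfl

theorem norm_pairingCLM_le (μ : RadonMeasure Ω) : ‖pairingCLM μ‖ ≤ radonNorm μ :=
  LinearMap.mkContinuous_norm_le _ measureReal_nonneg _

theorem dualPairing_sub_right (φ : C(Ω, ℝ)) (μ ν : RadonMeasure Ω) :
    dualPairing φ (μ - ν) = dualPairing φ μ - dualPairing φ ν :=
  VectorMeasure.integral_sub_vectorMeasure (integrable_radonMeasure φ μ)
    (integrable_radonMeasure φ ν)

theorem radonNorm_sub_le (μ ν : RadonMeasure Ω) :
    radonNorm (μ - ν) ≤ radonNorm μ + radonNorm ν := by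
  simp only [radonNorm, SignedMeasure.totalVariation_eq_variation]
  rw [← measureReal_add_apply]
  exact ENNReal.toReal_mono (measure_ne_top _ _) (VectorMeasure.variation_sub_le _)

theorem dualPairing_sum_smul_dirac (φ : C(Ω, ℝ)) {m : ℕ} (α : Fin m → ℝ) (x : Fin m → Ω) :
    dualPairing φ (∑ k, α k • (VectorMeasure.dirac (x k) (1 : ℝ) : RadonMeasure Ω)) =
      ∑ k, α k * φ (x k) := by
  rw [dualPairing, VectorMeasure.integral_finsetSum_vectorMeasure
    fun k _ => integrable_radonMeasure φ _]
  refine Finset.sum_congr rfl fun k _ => ?_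
  rw [VectorMeasure.integral_smul_vectorMeasure, VectorMeasure.integral_dirac]
  simp

theorem weakStarTendsto_iff_sub {μs : ℕ → RadonMeasure Ω} {μ : RadonMeasure Ω} :
    WeakStarTendsto μs μ ↔
      ∀ φ : C(Ω, ℝ), Tendsto (fun k => pairingCLM (μs k - μ) φ) atTop (𝓝 0) := by
  refine forall_congr' fun φ => ?_
  simp only [pairingCLM_apply, dualPairing_sub_right]
  exact tendsto_sub_nhds_zero_iff.symm

theorem convolutionOperator_apply_eq (ρ : C_c(Rn n, ℝ)) (μ : RadonMeasure Ω) (x : Ω) :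
    convolutionOperator Ω ρ μ x = pairingCLM μ (reflectedTranslate ρ x) := rfl

end Pairing

/-! ### Energies of kernels that factor through a feature map -/

section FeatureMap

open scoped ComplexConjugate

variable {X Y : Type*} [MeasurableSpace X] [MeasurableSpace Y] {m : Measure X} [IsFiniteMeasure m]
  {ν : Measure Y} [SFinite ν] {g : Y → X → ℂ} {C : ℝ} {h : X → ℝ}

/-- The integrand of the expanded energy is integrable: pointwise it is at most the mean of
`‖g s x‖²` and `‖g s y‖²`, whose integrals over `s` are bounded uniformly in `x`, `y`. -/
theorem integrable_feature_mul_conj_feature (hg : Measurable (Function.uncurry g))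
    (hint : ∀ x, Integrable (fun s => ‖g s x‖ ^ 2) ν) (hC : ∀ x, ∫ s, ‖g s x‖ ^ 2 ∂ν ≤ C)
    (hh : Measurable h) (hh1 : ∀ x, |h x| ≤ 1) :
    Integrable (fun z : (X × X) × Y => (g z.2 z.1.1 * h z.1.1) * (conj (g z.2 z.1.2) * h z.1.2))
      ((m.prod m).prod ν) := by
  have hg1 : Measurable fun z : (X × X) × Y => g z.2 z.1.1 :=
    hg.comp (measurable_snd.prodMk (measurable_fst.comp measurable_fst))
  have hg2 : Measurable fun z : (X × X) × Y => g z.2 z.1.2 :=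
    hg.comp (measurable_snd.prodMk (measurable_snd.comp measurable_fst))
  have hmeas : Measurable fun z : (X × X) × Y =>
      (g z.2 z.1.1 * h z.1.1) * (conj (g z.2 z.1.2) * h z.1.2) := by
    have := Complex.continuous_conj.measurable.comp hg2
    fun_prop
  have hbound : ∀ (p : X × X) (s : Y),
      ‖(g s p.1 * h p.1) * (conj (g s p.2) * h p.2)‖ ≤
        (‖g s p.1‖ ^ 2 + ‖g s p.2‖ ^ 2) / 2 := by
    intro p s
    have e1 : ‖g s p.1 * h p.1‖ ≤ ‖g s p.1‖ := by
      rw [norm_mul, Complex.norm_real]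
      exact mul_le_of_le_one_right (norm_nonneg _) (hh1 _)
    have e2 : ‖conj (g s p.2) * h p.2‖ ≤ ‖g s p.2‖ := by
      rw [norm_mul, Complex.norm_real, RCLike.norm_conj]
      exact mul_le_of_le_one_right (norm_nonneg _) (hh1 _)
    rw [norm_mul]
    have := mul_le_mul e1 e2 (norm_nonneg _) (norm_nonneg _)
    nlinarith [sq_nonneg (‖g s p.1‖ - ‖g s p.2‖)]
  have hsum : ∀ p : X × X, Integrable (fun s => (‖g s p.1‖ ^ 2 + ‖g s p.2‖ ^ 2) / 2) ν :=
    fun p => ((hint p.1).add (hint p.2)).div_const 2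
  have hsec : ∀ p : X × X,
      Integrable (fun s => (g s p.1 * h p.1) * (conj (g s p.2) * h p.2)) ν := fun p =>
    (hsum p).mono' (hmeas.comp measurable_prodMk_left).aestronglyMeasurable
      (Eventually.of_forall (hbound p))
  rw [integrable_prod_iff hmeas.aestronglyMeasurable]
  refine ⟨Eventually.of_forall hsec, Integrable.of_bound (C := C) ?_ ?_⟩
  · exact hmeas.aestronglyMeasurable.norm.integral_prod_right'
  · refine Eventually.of_forall fun p => ?_
    rw [Real.norm_of_nonneg (integral_nonneg fun _ => norm_nonneg _)]
    calc ∫ s, ‖(g s p.1 * h p.1) * (conj (g s p.2) * h p.2)‖ ∂ν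
        ≤ ∫ s, (‖g s p.1‖ ^ 2 + ‖g s p.2‖ ^ 2) / 2 ∂ν :=
          integral_mono (hsec p).norm (hsum p) (hbound p)
      _ = (∫ s, ‖g s p.1‖ ^ 2 ∂ν + ∫ s, ‖g s p.2‖ ^ 2 ∂ν) / 2 := by
          rw [integral_div, integral_add (hint _) (hint _)]
      _ ≤ C := by linarith [hC p.1, hC p.2]

/-- If a kernel factors as `K x y = ∫ g(s, x) conj (g(s, y)) dν(s)`, then its energy is the
squared `L²` norm of the feature transform `s ↦ ∫ g(s, x) h(x) dm(x)`. -/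
theorem integral_integral_kernel_eq_integral_sq (hg : Measurable (Function.uncurry g))
    (hint : ∀ x, Integrable (fun s => ‖g s x‖ ^ 2) ν) (hC : ∀ x, ∫ s, ‖g s x‖ ^ 2 ∂ν ≤ C)
    (hh : Measurable h) (hh1 : ∀ x, |h x| ≤ 1) {K : X → X → ℝ}
    (hK : ∀ x y, (K x y : ℂ) = ∫ s, g s x * conj (g s y) ∂ν) :
    Integrable (fun s => ‖∫ x, g s x * h x ∂m‖ ^ 2) ν ∧
      ∫ x, (∫ y, K x y * h y ∂m) * h x ∂m = ∫ s, ‖∫ x, g s x * h x ∂m‖ ^ 2 ∂ν := by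
  have hI := integrable_feature_mul_conj_feature (m := m) hg hint hC hh hh1
  have hsq : ∀ s, ∫ p : X × X, (g s p.1 * h p.1) * (conj (g s p.2) * h p.2) ∂(m.prod m) =
      ((‖∫ x, g s x * h x ∂m‖ ^ 2 : ℝ) : ℂ) := by
    intro s
    rw [integral_prod_mul (fun x => g s x * (h x : ℂ)) (fun y => conj (g s y) * (h y : ℂ))]
    have : ∫ y, conj (g s y) * (h y : ℂ) ∂m = conj (∫ y, g s y * (h y : ℂ) ∂m) := by
      rw [← integral_conj]
      simp
    rw [this, Complex.mul_conj']
    simp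
  have hpair : ∀ p : X × X, ∫ s, (g s p.1 * h p.1) * (conj (g s p.2) * h p.2) ∂ν =
      ((K p.1 p.2 * h p.2 * h p.1 : ℝ) : ℂ) := by
    intro p
    rw [Complex.ofReal_mul, Complex.ofReal_mul, hK, mul_assoc, ← integral_mul_const]
    congr 1 with s
    ring
  have hright := hI.integral_prod_right
  have hleft := hI.integral_prod_left
  simp only [hsq] at hright
  simp only [hpair] at hleft
  refine ⟨by simpa only [RCLike.re_eq_complex_re, Complex.ofReal_re] using hright.re, ?_⟩
  have hleft' : Integrable (fun p : X × X => K p.1 p.2 * h p.2 * h p.1) (m.prod m) := by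
    simpa only [RCLike.re_eq_complex_re, Complex.ofReal_re] using hleft.re
  have hswap := integral_integral_swap (f := fun (p : X × X) (s : Y) =>
    (g s p.1 * h p.1) * (conj (g s p.2) * h p.2)) hI
  simp only [hsq, hpair] at hswap
  have e1 : ∫ p : X × X, K p.1 p.2 * h p.2 * h p.1 ∂(m.prod m) =
      ∫ s, ‖∫ x, g s x * h x ∂m‖ ^ 2 ∂ν := by
    rw [← Complex.ofReal_inj]
    exact (integral_ofReal (𝕜 := ℂ)).symm.trans (hswap.trans (integral_ofReal (𝕜 := ℂ)))
  rw [← e1, integral_prod _ hleft']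
  simp only [integral_mul_const]

end FeatureMap

/-! ### Integrability of nonnegative Fourier transforms -/

section NonnegFourier

variable {V : Type*} [NormedAddCommGroup V] [InnerProductSpace ℝ V] [MeasurableSpace V]
  [BorelSpace V] [FiniteDimensional ℝ V]

theorem continuous_fourier {f : V → ℂ} (hf : Integrable f) : Continuous (𝓕 f) :=
  VectorFourier.fourierIntegral_continuous Real.continuous_fourierChar
    (by exact continuous_inner) hf

theorem norm_fourier_le {f : V → ℂ} (ξ : V) : ‖𝓕 f ξ‖ ≤ ∫ x, ‖f x‖ :=
  VectorFourier.norm_fourierIntegral_le_integral_norm _ _ _ _ _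

/-- Gaussian summation of the inverse Fourier integral at the origin. -/
theorem tendsto_integral_cexp_smul_fourier {f : V → ℂ} (hf : Integrable f)
    (hc : ContinuousAt f 0) :
    Tendsto (fun c : ℝ => ∫ w : V, Complex.exp (-(c : ℂ)⁻¹ * ‖w‖ ^ 2) • 𝓕 f w) atTop (𝓝 (f 0)) := by
  refine (Real.tendsto_integral_gaussian_smul' hf hc).congr' ?_
  filter_upwards [Ioi_mem_atTop 0] with c (hc : 0 < c)
  have J : Integrable (fun w : V => Complex.exp (-(c : ℂ)⁻¹ * ‖w‖ ^ 2 + 0 * inner ℝ (0 : V) w)) :=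
    GaussianFourier.integrable_cexp_neg_mul_sq_norm_add (by simpa) _ _
  have key := VectorFourier.integral_fourierIntegral_smul_eq_flip (L := innerₗ V)
    (μ := volume) (ν := volume) Real.continuous_fourierChar continuous_inner J hf
  simp only [zero_mul, add_zero, flip_innerₗ] at key
  refine Eq.trans ?_ key
  congr with w
  refine Eq.trans ?_ (congrArg (· • f w)
    (fourier_gaussian_innerProductSpace (V := V) (b := (c : ℂ)⁻¹) (by simpa) w)).symm
  simp only [div_inv_eq_mul, zero_sub, norm_neg]
  ring_nf

/-- A function which is integrable, continuous at the origin and has a nonnegative Fourier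
transform has an integrable Fourier transform: by Fatou's lemma the Gaussian means of `𝓕 f`, which
converge to `f 0`, bound its integral. -/
theorem integrable_fourier_of_nonneg {f : V → ℂ} (hf : Integrable f) (hc : ContinuousAt f 0)
    (hpos : ∀ ξ, (𝓕 f ξ).im = 0 ∧ 0 ≤ (𝓕 f ξ).re) : Integrable (𝓕 f) := by
  have hcont := continuous_fourier hf
  have hre : ∀ ξ, 𝓕 f ξ = ((𝓕 f ξ).re : ℂ) := fun ξ =>
    Complex.ext (by simp) (by simp [(hpos ξ).1])
  -- at `k = 0` the weight `exp (-(0⁻¹) ‖ξ‖²)` is `1`, so integrability needs `0 < k`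
  set G : ℕ → V → ℝ := fun k ξ => Real.exp (-(k : ℝ)⁻¹ * ‖ξ‖ ^ 2) * (𝓕 f ξ).re with hG
  have hGc : ∀ k, Continuous (G k) := fun k =>
    (by fun_prop : Continuous fun ξ : V => Real.exp (-(k : ℝ)⁻¹ * ‖ξ‖ ^ 2)).mul
      (Complex.continuous_re.comp hcont)
  have hG0 : ∀ k ξ, 0 ≤ G k ξ := fun k ξ => mul_nonneg (Real.exp_pos _).le (hpos ξ).2
  have hGint : ∀ k : ℕ, 0 < k → Integrable (G k) := by
    intro k hk
    have J := GaussianFourier.integrable_cexp_neg_mul_sq_norm_add (V := V) (b := (k : ℂ)⁻¹)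
      (by simpa using! hk) 0 0
    have J' : Integrable fun ξ : V => Real.exp (-(k : ℝ)⁻¹ * ‖ξ‖ ^ 2) := by
      refine J.re.congr (Eventually.of_forall fun ξ => ?_)
      have : -(k : ℂ)⁻¹ * (‖ξ‖ : ℂ) ^ 2 + 0 * (inner ℝ 0 ξ : ℝ) =
        ((-(k : ℝ)⁻¹ * ‖ξ‖ ^ 2 : ℝ) : ℂ) := by push_cast; ring
      simp only [this, RCLike.re_eq_complex_re, Complex.exp_ofReal_re]
    refine J'.mul_bdd (c := ∫ x, ‖f x‖) (Complex.continuous_re.comp hcont).aestronglyMeasurable ?_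
    exact Eventually.of_forall fun ξ => (Complex.abs_re_le_norm _).trans (norm_fourier_le ξ)
  have hlim : Tendsto (fun k : ℕ => ∫ ξ, G k ξ) atTop (𝓝 (f 0).re) := by
    have h1 := (Complex.continuous_re.tendsto _).comp
      ((tendsto_integral_cexp_smul_fourier hf hc).comp tendsto_natCast_atTop_atTop)
    refine h1.congr fun k => ?_
    have : ∀ w : V, Complex.exp (-((k : ℝ) : ℂ)⁻¹ * ‖w‖ ^ 2) • 𝓕 f w = ((G k w : ℝ) : ℂ) := by
      intro w
      rw [hre w]
      simp [hG]
    simp only [Function.comp_apply, this]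
    exact (congrArg Complex.re (integral_ofReal (𝕜 := ℂ))).trans (Complex.ofReal_re _)
  have hfatou := lintegral_liminf_le (μ := (volume : Measure V))
    (f := fun k ξ => ENNReal.ofReal (G k ξ)) (u := atTop)
    fun k => (hGc k).measurable.ennreal_ofReal
  have hliml : ∀ ξ, liminf (fun k => ENNReal.ofReal (G k ξ)) atTop =
      ENNReal.ofReal (𝓕 f ξ).re := by
    intro ξ
    refine Tendsto.liminf_eq (ENNReal.tendsto_ofReal ?_)
    have h0 : Tendsto (fun k : ℕ => -(k : ℝ)⁻¹ * ‖ξ‖ ^ 2) atTop (𝓝 0) := by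
      simpa using (tendsto_inv_atTop_nhds_zero_nat (𝕜 := ℝ)).neg.mul_const (‖ξ‖ ^ 2)
    simpa [hG] using ((Real.continuous_exp.tendsto _).comp h0).mul_const (𝓕 f ξ).re
  have hlimr : liminf (fun k => ∫⁻ ξ, ENNReal.ofReal (G k ξ)) atTop =
      ENNReal.ofReal (f 0).re := by
    refine Tendsto.liminf_eq ((ENNReal.tendsto_ofReal hlim).congr' ?_)
    filter_upwards [eventually_gt_atTop 0] with k hk
    exact ofReal_integral_eq_lintegral_ofReal (hGint k hk) (Eventually.of_forall (hG0 k))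
  simp only [hliml, hlimr] at hfatou
  have hreint : Integrable fun ξ => (𝓕 f ξ).re := by
    refine ⟨(Complex.continuous_re.comp hcont).aestronglyMeasurable, ?_⟩
    rw [hasFiniteIntegral_iff_ofReal (Eventually.of_forall fun ξ => (hpos ξ).2)]
    exact hfatou.trans_lt ENNReal.ofReal_lt_top
  exact hreint.ofReal.congr (Eventually.of_forall fun ξ => (hre ξ).symm)

end NonnegFourier

/-! ### Self-adjointness of the convolution operator -/

section SelfAdjoint

variable {n : ℕ} {Ω : Compacts (Rn n)}

/-- Iterating the integral against polar decompositions of `μ` and `ν`. -/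
theorem dualPairing_convolutionOperator_eq (ρ : C_c(Rn n, ℝ)) {μ ν : RadonMeasure Ω}
    {h k : Ω → ℝ} (hμ : ∀ φ : C(Ω, ℝ), dualPairing φ μ = ∫ x, φ x * h x ∂μ.totalVariation)
    (hν : ∀ φ : C(Ω, ℝ), dualPairing φ ν = ∫ x, φ x * k x ∂ν.totalVariation) :
    dualPairing (convolutionOperator Ω ρ μ) ν =
      ∫ x, (∫ y, ρ ((x : Rn n) - y) * h y ∂μ.totalVariation) * k x ∂ν.totalVariation := by
  rw [hν]
  congr 1 with x
  rw [convolutionOperator_apply_eq, pairingCLM_apply, hμ]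
  rfl

theorem isPreSelfAdjoint_convolutionOperator {ρ : C_c(Rn n, ℝ)} (hρ : IsSymmetricKernel ρ) :
    IsPreSelfAdjoint (convolutionOperator Ω ρ) := by
  intro μ ν
  obtain ⟨h, hm, hh, hμ⟩ := exists_sign_density μ
  obtain ⟨k, km, kk, hν⟩ := exists_sign_density ν
  obtain ⟨C, hC0, hC⟩ := exists_abs_le_kernel ρ
  rw [dualPairing_convolutionOperator_eq ρ hμ hν, dualPairing_convolutionOperator_eq ρ hν hμ]
  simp only [← integral_mul_const]
  rw [integral_integral_swap]
  · congr 1 with y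
    congr 1 with x
    rw [← hρ ((x : Rn n) - y), neg_sub]
    ring
  · refine Integrable.of_bound (C := C) (Measurable.aestronglyMeasurable ?_) ?_
    · have : Measurable fun p : Ω × Ω => ρ ((p.1 : Rn n) - p.2) :=
        (ρ.continuous.comp (by fun_prop)).measurable
      exact (this.mul (hm.comp measurable_snd)).mul (km.comp measurable_fst)
    · refine Eventually.of_forall fun p => ?_
      simp only [Function.uncurry, norm_mul, Real.norm_eq_abs]
      calc |ρ ((p.1 : Rn n) - p.2)| * |h p.2| * |k p.1| ≤ C * 1 * 1 := by
            gcongr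
            exacts [hC _, hh _, kk _]
        _ = C := by ring

end SelfAdjoint

/-! ### The spectral form of the energy and its positivity -/

section Spectral

variable {n : ℕ} {Ω : Compacts (Rn n)}

/-- The function `x ↦ cos (2π⟨x, ξ⟩)` on `Ω`. -/
noncomputable def cosWave (Ω : Compacts (Rn n)) (ξ : Rn n) : C(Ω, ℝ) where
  toFun x := Real.cos (2 * Real.pi * inner ℝ (x : Rn n) ξ)
  continuous_toFun := by fun_prop

/-- The function `x ↦ sin (2π⟨x, ξ⟩)` on `Ω`. -/
noncomputable def sinWave (Ω : Compacts (Rn n)) (ξ : Rn n) : C(Ω, ℝ) where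
  toFun x := Real.sin (2 * Real.pi * inner ℝ (x : Rn n) ξ)
  continuous_toFun := by fun_prop

/-- `|μ̂(ξ)|²`, the squared modulus of the Fourier transform of `μ`, written through its real and
imaginary parts. -/
noncomputable def fourierModulusSq (μ : RadonMeasure Ω) (ξ : Rn n) : ℝ :=
  dualPairing (cosWave Ω ξ) μ ^ 2 + dualPairing (sinWave Ω ξ) μ ^ 2

theorem fourierModulusSq_nonneg (μ : RadonMeasure Ω) (ξ : Rn n) : 0 ≤ fourierModulusSq μ ξ := by
  unfold fourierModulusSq; positivity

theorem fourierModulusSq_eq_zero_iff {μ : RadonMeasure Ω} {ξ : Rn n} :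
    fourierModulusSq μ ξ = 0 ↔
      dualPairing (cosWave Ω ξ) μ = 0 ∧ dualPairing (sinWave Ω ξ) μ = 0 := by
  rw [fourierModulusSq, add_eq_zero_iff_of_nonneg (sq_nonneg _) (sq_nonneg _)]
  simp

/-- A signed measure on `Ω` is determined by its trigonometric moments: those of the positive and
negative parts give the characteristic functions of their images in `ℝⁿ`. -/
theorem eq_zero_of_fourierModulusSq_eq_zero {μ : RadonMeasure Ω}
    (h : ∀ ξ, fourierModulusSq μ ξ = 0) : μ = 0 := by
  set P := μ.toJordanDecomposition.posPart
  set N := μ.toJordanDecomposition.negPart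
  have hcos : ∀ ξ, ∫ x, cosWave Ω ξ x ∂P = ∫ x, cosWave Ω ξ x ∂N := fun ξ => by
    rw [← sub_eq_zero, ← dualPairing_eq_integral_posPart_sub_negPart]
    exact (fourierModulusSq_eq_zero_iff.1 (h ξ)).1
  have hsin : ∀ ξ, ∫ x, sinWave Ω ξ x ∂P = ∫ x, sinWave Ω ξ x ∂N := fun ξ => by
    rw [← sub_eq_zero, ← dualPairing_eq_integral_posPart_sub_negPart]
    exact (fourierModulusSq_eq_zero_iff.1 (h ξ)).2
  have hchar : ∀ (m : Measure Ω) [IsFiniteMeasure m] (t : Rn n),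
      charFun (m.map ((↑) : Ω → Rn n)) t =
        ((∫ x, cosWave Ω ((2 * Real.pi)⁻¹ • t) x ∂m : ℝ) : ℂ) +
          ((∫ x, sinWave Ω ((2 * Real.pi)⁻¹ • t) x ∂m : ℝ) : ℂ) * Complex.I := by
    intro m _ t
    have hint : ∀ φ : C(Ω, ℝ), Integrable (fun x => (φ x : ℂ)) m := fun φ =>
      (Integrable.of_bound (C := ‖φ‖) φ.continuous.measurable.aestronglyMeasurable
        (Eventually.of_forall φ.norm_coe_le_norm)).ofReal
    rw [charFun_apply, integral_map measurable_subtype_coe.aemeasurable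
      (by fun_prop : Continuous _).aestronglyMeasurable, ← integral_complex_ofReal,
      ← integral_complex_ofReal, ← integral_mul_const,
      ← integral_add (hint _) ((hint _).mul_const _)]
    congr 1 with x
    rw [Complex.exp_mul_I]
    have : 2 * Real.pi * inner ℝ (x : Rn n) ((2 * Real.pi)⁻¹ • t) = inner ℝ (x : Rn n) t := by
      rw [inner_smul_right]; field_simp
    have ec : cosWave Ω ((2 * Real.pi)⁻¹ • t) x = Real.cos (inner ℝ (x : Rn n) t) :=
      congrArg Real.cos this
    have es : sinWave Ω ((2 * Real.pi)⁻¹ • t) x = Real.sin (inner ℝ (x : Rn n) t) :=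
      congrArg Real.sin this
    rw [ec, es, Complex.ofReal_cos, Complex.ofReal_sin]
  have hmap : P.map ((↑) : Ω → Rn n) = N.map ((↑) : Ω → Rn n) := by
    refine Measure.ext_of_charFun (funext fun t => ?_)
    rw [hchar, hchar, hcos, hsin]
  have hPN : P = N := by
    have he : MeasurableEmbedding ((↑) : Ω → Rn n) :=
      MeasurableEmbedding.subtype_coe Ω.isCompact.isClosed.measurableSet
    rw [← he.comap_map P, hmap, he.comap_map]
  have hJ := μ.toSignedMeasure_toJordanDecomposition
  rw [← hJ, JordanDecomposition.toSignedMeasure, sub_eq_zero]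
  change P.toSignedMeasure = N.toSignedMeasure
  simp only [hPN]

theorem integrable_ofReal_kernel (ρ : C_c(Rn n, ℝ)) :
    Integrable (fun x : Rn n => (ρ x : ℂ)) :=
  (ρ.continuous.integrable_of_hasCompactSupport ρ.hasCompactSupport).ofReal

theorem integrable_fourier_kernel {ρ : C_c(Rn n, ℝ)} (hρ : IsPosSemidefKernel ρ) :
    Integrable (𝓕 (fun x : Rn n => (ρ x : ℂ))) :=
  integrable_fourier_of_nonneg (integrable_ofReal_kernel ρ)
    (Complex.continuous_ofReal.comp ρ.continuous).continuousAt hρ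

theorem fourierInv_fourier_kernel {ρ : C_c(Rn n, ℝ)} (hρ : IsPosSemidefKernel ρ) :
    𝓕⁻ (𝓕 (fun x : Rn n => (ρ x : ℂ))) = fun x : Rn n => (ρ x : ℂ) :=
  (Complex.continuous_ofReal.comp ρ.continuous).fourierInv_fourier_eq
    (integrable_ofReal_kernel ρ) (integrable_fourier_kernel hρ)

/-- **Spectral form of the energy**: `⟨ρ * μ, μ⟩ = ∫ ρ̂(ξ) |μ̂(ξ)|² dξ`. -/
theorem dualPairing_convolutionOperator_eq_integral_fourier {ρ : C_c(Rn n, ℝ)}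
    (hρ : IsPosSemidefKernel ρ) (μ : RadonMeasure Ω) :
    Integrable (fun ξ => (𝓕 (fun x : Rn n => (ρ x : ℂ)) ξ).re * fourierModulusSq μ ξ) ∧
    dualPairing (convolutionOperator Ω ρ μ) μ =
      ∫ ξ, (𝓕 (fun x : Rn n => (ρ x : ℂ)) ξ).re * fourierModulusSq μ ξ := by
  obtain ⟨h, hm, hh, hμ⟩ := exists_sign_density μ
  set R : Rn n → ℝ := fun ξ => (𝓕 (fun x : Rn n => (ρ x : ℂ)) ξ).re with hR
  have hR0 : ∀ ξ, 0 ≤ R ξ := fun ξ => (hρ ξ).2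
  have hRF : ∀ ξ, 𝓕 (fun x : Rn n => (ρ x : ℂ)) ξ = (R ξ : ℂ) := fun ξ =>
    Complex.ext (by simp [hR]) (by simp [(hρ ξ).1])
  have hRc : Continuous R :=
    Complex.continuous_re.comp (continuous_fourier (integrable_ofReal_kernel ρ))
  have hRint : Integrable R := (integrable_fourier_kernel hρ).re
  -- the square root of `ρ̂` splits the kernel into its two features
  set g : Rn n → Ω → ℂ := fun ξ x =>
    (√(R ξ) : ℂ) * Complex.exp ((2 * Real.pi * inner ℝ (x : Rn n) ξ : ℝ) * Complex.I) with hg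
  have hgc : Continuous (Function.uncurry g) := by
    have h1 : Continuous fun p : Rn n × Ω => R p.1 := hRc.comp continuous_fst
    have h2 : Continuous fun p : Rn n × Ω => (2 * Real.pi * inner ℝ (p.2 : Rn n) p.1 : ℝ) := by
      fun_prop
    exact (Complex.continuous_ofReal.comp h1.sqrt).mul
      (Complex.continuous_exp.comp ((Complex.continuous_ofReal.comp h2).mul continuous_const))
  have hgn : ∀ ξ x, ‖g ξ x‖ ^ 2 = R ξ := fun ξ x => by
    simp only [hg]
    rw [norm_mul, Complex.norm_exp_ofReal_mul_I, mul_one, Complex.norm_real,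
      Real.norm_of_nonneg (Real.sqrt_nonneg _), Real.sq_sqrt (hR0 ξ)]
  have hK : ∀ x y : Ω, (ρ ((x : Rn n) - y) : ℂ) =
      ∫ ξ, g ξ x * (starRingEnd ℂ) (g ξ y) := by
    intro x y
    rw [← congrFun (fourierInv_fourier_kernel hρ) ((x : Rn n) - y), Real.fourierInv_eq']
    congr 1 with ξ
    have hs : (√(R ξ) : ℂ) * (√(R ξ) : ℂ) = R ξ := by
      rw [← Complex.ofReal_mul, Real.mul_self_sqrt (hR0 ξ)]
    rw [hRF, smul_eq_mul, ← hs]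
    simp only [hg, map_mul, Complex.conj_ofReal, ← Complex.exp_conj, Complex.conj_I]
    rw [mul_mul_mul_comm, ← Complex.exp_add, mul_comm]
    congr 2
    rw [inner_sub_right, real_inner_comm (x : Rn n), real_inner_comm (y : Rn n)]
    push_cast
    ring
  have hfeat : ∀ ξ, ‖∫ x, g ξ x * h x ∂μ.totalVariation‖ ^ 2 = R ξ * fourierModulusSq μ ξ := by
    intro ξ
    have hint : ∀ φ : C(Ω, ℝ), Integrable (fun x => ((φ x * h x : ℝ) : ℂ)) μ.totalVariation := by
      intro φ
      refine (Integrable.of_bound (C := ‖φ‖)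
        (φ.continuous.measurable.mul hm).aestronglyMeasurable
        (Eventually.of_forall fun x => ?_)).ofReal
      rw [Pi.mul_apply, norm_mul]
      exact (mul_le_of_le_one_right (norm_nonneg _) (hh x)).trans (φ.norm_coe_le_norm x)
    have : ∫ x, g ξ x * h x ∂μ.totalVariation = (√(R ξ) : ℂ) *
        ((dualPairing (cosWave Ω ξ) μ : ℂ) + (dualPairing (sinWave Ω ξ) μ : ℂ) * Complex.I) := by
      rw [hμ, hμ, ← integral_complex_ofReal, ← integral_complex_ofReal, ← integral_mul_const,
        ← integral_add (hint _) ((hint _).mul_const _), ← integral_const_mul]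
      congr 1 with x
      simp only [hg, Complex.exp_mul_I, cosWave, sinWave, ContinuousMap.coe_mk,
        Complex.ofReal_mul, Complex.ofReal_cos, Complex.ofReal_sin]
      ring
    rw [this, norm_mul, mul_pow, Complex.norm_real, Real.norm_of_nonneg (Real.sqrt_nonneg _),
      Real.sq_sqrt (hR0 ξ), Complex.sq_norm, Complex.normSq_add_mul_I, fourierModulusSq]
  have main := integral_integral_kernel_eq_integral_sq (m := μ.totalVariation)
    (ν := (volume : Measure (Rn n))) (g := g) (C := ∫ ξ, R ξ) hgc.measurable
    (fun x => by simpa only [hgn] using hRint) (fun x => by simp only [hgn, le_refl]) hm hh hK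
  simp only [hfeat] at main
  rw [dualPairing_convolutionOperator_eq ρ hμ hμ]
  exact main

theorem isPrePosSemidef_convolutionOperator {ρ : C_c(Rn n, ℝ)} (hρ : IsPosSemidefKernel ρ) :
    IsPrePosSemidef (convolutionOperator Ω ρ) := by
  intro μ
  rw [(dualPairing_convolutionOperator_eq_integral_fourier hρ μ).2]
  exact integral_nonneg fun ξ => mul_nonneg (hρ ξ).2 (fourierModulusSq_nonneg μ ξ)

/-- The Fourier transform of a discrete measure is a trigonometric polynomial, hence analytic; if
it vanishes on the nonempty open set `{ρ̂ > 0}` it vanishes identically. -/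
theorem isPrePosDefOn_discreteMeasures {ρ : C_c(Rn n, ℝ)} (hne : ρ ≠ 0)
    (hρ : IsPosSemidefKernel ρ) :
    IsPrePosDefOn (convolutionOperator Ω ρ) (discreteMeasures Ω) := by
  rintro μ ⟨m, α, x, rfl⟩ hμ
  set μ : RadonMeasure Ω := ∑ k, α k • (VectorMeasure.dirac (x k) (1 : ℝ) : RadonMeasure Ω)
  refine lt_of_le_of_ne (isPrePosSemidef_convolutionOperator hρ μ) fun h0 => hμ ?_
  obtain ⟨hint, heq⟩ := dualPairing_convolutionOperator_eq_integral_fourier hρ μ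
  rw [heq] at h0
  have hcos : (fun ξ => dualPairing (cosWave Ω ξ) μ) =
      fun ξ => ∑ k, α k * Real.cos (2 * Real.pi * inner ℝ ((x k : Ω) : Rn n) ξ) :=
    funext fun ξ => dualPairing_sum_smul_dirac _ α x
  have hsin : (fun ξ => dualPairing (sinWave Ω ξ) μ) =
      fun ξ => ∑ k, α k * Real.sin (2 * Real.pi * inner ℝ ((x k : Ω) : Rn n) ξ) :=
    funext fun ξ => dualPairing_sum_smul_dirac _ α x
  have hphase : ∀ k, AnalyticOnNhd ℝ
      (fun ξ : Rn n => 2 * Real.pi * inner ℝ ((x k : Ω) : Rn n) ξ) Set.univ := fun k =>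
    analyticOnNhd_const.mul ((innerSL ℝ ((x k : Ω) : Rn n)).analyticOnNhd _)
  have hcosA : AnalyticOnNhd ℝ (fun ξ => dualPairing (cosWave Ω ξ) μ) Set.univ := by
    rw [hcos]
    exact Finset.analyticOnNhd_fun_sum _ fun k _ => analyticOnNhd_const.mul
      ((Real.analyticOnNhd_cos (s := Set.univ)).comp (hphase k) fun _ _ => Set.mem_univ _)
  have hsinA : AnalyticOnNhd ℝ (fun ξ => dualPairing (sinWave Ω ξ) μ) Set.univ := by
    rw [hsin]
    exact Finset.analyticOnNhd_fun_sum _ fun k _ => analyticOnNhd_const.mul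
      ((Real.analyticOnNhd_sin (s := Set.univ)).comp (hphase k) fun _ _ => Set.mem_univ _)
  have hRc : Continuous fun ξ => (𝓕 (fun x : Rn n => (ρ x : ℂ)) ξ).re :=
    Complex.continuous_re.comp (continuous_fourier (integrable_ofReal_kernel ρ))
  have hmodc : Continuous (fourierModulusSq μ) :=
    ((continuousOn_univ.1 hcosA.continuousOn).pow 2).add
      ((continuousOn_univ.1 hsinA.continuousOn).pow 2)
  have hprod : (fun ξ => (𝓕 (fun x : Rn n => (ρ x : ℂ)) ξ).re * fourierModulusSq μ ξ) = 0 := by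
    refine Continuous.ae_eq_iff_eq (μ := volume) (hRc.mul hmodc) continuous_zero |>.1 ?_
    exact (integral_eq_zero_iff_of_nonneg
      (fun ξ => mul_nonneg (hρ ξ).2 (fourierModulusSq_nonneg μ ξ)) hint).1 h0.symm
  obtain ⟨ξ₀, hξ₀⟩ : ∃ ξ, (𝓕 (fun x : Rn n => (ρ x : ℂ)) ξ).re ≠ 0 := by
    by_contra! hzero
    have hF : 𝓕 (fun x : Rn n => (ρ x : ℂ)) = 0 :=
      funext fun ξ => Complex.ext (hzero ξ) (hρ ξ).1
    refine hne (DFunLike.ext _ _ fun z => ?_)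
    have := congrFun (fourierInv_fourier_kernel hρ) z
    rw [hF, Real.fourierInv_eq] at this
    simpa using this.symm
  have hev : ∀ᶠ ξ in 𝓝 ξ₀, fourierModulusSq μ ξ = 0 := by
    filter_upwards [hRc.continuousAt.eventually_ne hξ₀] with ξ hξ
    exact (mul_eq_zero.1 (congrFun hprod ξ)).resolve_left hξ
  have hc0 := hcosA.eq_of_eventuallyEq (g := fun _ => 0) analyticOnNhd_const
    (hev.mono fun ξ hξ => (fourierModulusSq_eq_zero_iff.1 hξ).1)
  have hs0 := hsinA.eq_of_eventuallyEq (g := fun _ => 0) analyticOnNhd_const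
    (hev.mono fun ξ hξ => (fourierModulusSq_eq_zero_iff.1 hξ).2)
  exact eq_zero_of_fourierModulusSq_eq_zero fun ξ =>
    fourierModulusSq_eq_zero_iff.2 ⟨congrFun hc0 ξ, congrFun hs0 ξ⟩

end Spectral

/-! ### Weak-* convergence implies convergence of the energy -/

section WeakStarToSeminorm

variable {n : ℕ} {Ω : Compacts (Rn n)}

theorem continuous_reflectedTranslate (ρ : C_c(Rn n, ℝ)) :
    Continuous fun x : Ω => (reflectedTranslate ρ x : C(Ω, ℝ)) :=
  ContinuousMap.continuous_of_continuous_uncurry _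
    (ρ.continuous.comp (by fun_prop : Continuous fun p : Ω × Ω => (p.1 : Rn n) - p.2))

/-- By the uniform boundedness principle the functionals of a weak-* null sequence are
equicontinuous, so their convergence to zero is uniform on the compact set of translates of `ρ`. -/
theorem tendsto_dualPairing_of_weakStarTendsto (ρ : C_c(Rn n, ℝ)) {ν : ℕ → RadonMeasure Ω}
    (hν : ∀ φ : C(Ω, ℝ), Tendsto (fun k => pairingCLM (ν k) φ) atTop (𝓝 0)) :
    Tendsto (fun k => dualPairing (convolutionOperator Ω ρ (ν k)) (ν k)) atTop (𝓝 0) := by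
  obtain ⟨M, hM⟩ : ∃ M, ∀ k, ‖pairingCLM (ν k)‖ ≤ M := by
    refine banach_steinhaus fun φ => ?_
    obtain ⟨C, hC⟩ := (Metric.isBounded_range_of_tendsto _ (hν φ)).exists_norm_le
    exact ⟨C, fun k => hC _ ⟨k, rfl⟩⟩
  have hequi : Equicontinuous fun k => (convolutionOperator Ω ρ (ν k) : Ω → ℝ) := by
    have h1 : UniformEquicontinuous fun k => (pairingCLM (ν k) : C(Ω, ℝ) → ℝ) :=
      LipschitzWith.uniformEquicontinuous _ M.toNNReal fun k =>
        (pairingCLM (ν k)).lipschitz.weaken (by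
          rw [← NNReal.coe_le_coe, coe_nnnorm]
          exact (hM k).trans (Real.le_coe_toNNReal M))
    intro x₀
    exact fun U hU => (continuous_reflectedTranslate ρ).continuousAt.eventually
      (h1.equicontinuous _ U hU)
  have hunif := (hequi.tendsto_uniformFun_iff_pi atTop 0).2
    (tendsto_pi_nhds.2 fun x => hν (reflectedTranslate ρ x))
  have hnorm : Tendsto (fun k => convolutionOperator Ω ρ (ν k)) atTop (𝓝 0) :=
    ContinuousMap.tendsto_iff_tendstoUniformly.2
      (UniformFun.tendsto_iff_tendstoUniformly.1 hunif)
  refine squeeze_zero_norm (fun k => ?_) (by simpa using (hnorm.norm.const_mul M))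
  rw [← pairingCLM_apply]
  exact (pairingCLM (ν k)).le_of_opNorm_le (hM k) _

theorem tendsto_opSeminorm_of_weakStarTendsto (ρ : C_c(Rn n, ℝ)) {μs : ℕ → RadonMeasure Ω}
    {μ : RadonMeasure Ω} (h : WeakStarTendsto μs μ) :
    Tendsto (fun k => opSeminorm (convolutionOperator Ω ρ) (μs k - μ)) atTop (𝓝 0) := by
  simpa [opSeminorm] using
    (tendsto_dualPairing_of_weakStarTendsto ρ (weakStarTendsto_iff_sub.1 h)).sqrt

end WeakStarToSeminorm

/-! ### The convolution theorem on `L²` and uniqueness on `L¹` -/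

section PlancherelConvolution

open scoped SchwartzMap

variable {V : Type*} [NormedAddCommGroup V] [InnerProductSpace ℝ V] [MeasurableSpace V]
  [BorelSpace V] [FiniteDimensional ℝ V]

theorem SchwartzMap.convolution_apply_eq_fourierInv (f g : 𝓢(V, ℂ)) (x : V) :
    ∫ t, f t * g (x - t) = 𝓕⁻ (fun ξ => 𝓕 f ξ * 𝓕 g ξ) x := by
  have h := SchwartzMap.convolution_apply (ContinuousLinearMap.mul ℂ ℂ) f g x
  refine Eq.trans (Eq.trans rfl h.symm) ?_
  change (𝓕⁻ (SchwartzMap.pairing (ContinuousLinearMap.mul ℂ ℂ) (𝓕 f) (𝓕 g))) x = _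
  rw [SchwartzMap.fourierInv_coe]
  rfl

theorem continuous_fourierInv_apply_l1 (x : V) :
    Continuous fun w : Lp ℂ 1 (volume : Measure V) => 𝓕⁻ (w : V → ℂ) x := by
  have h : ∀ w : Lp ℂ 1 (volume : Measure V),
      𝓕⁻ (w : V → ℂ) x = Real.Lp.fourierTransformInvCLM V ℂ w x := fun w => by
    rw [Real.Lp.fourierTransformInvCLM_apply, Real.Lp.coe_fourierTransformInv]
  simp only [h]
  exact (BoundedContinuousFunction.evalCLM ℂ x).continuous.comp
    (Real.Lp.fourierTransformInvCLM V ℂ).continuous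

theorem continuous_fourierInv_mul_fourier_l2 (x : V) :
    Continuous fun p : Lp ℂ 2 (volume : Measure V) × Lp ℂ 2 (volume : Measure V) =>
      𝓕⁻ (fun ξ => 𝓕 p.1 ξ * 𝓕 p.2 ξ : V → ℂ) x := by
  have h1 : Continuous fun f : Lp ℂ 2 (volume : Measure V) => 𝓕 f :=
    (Lp.fourierTransformₗᵢ V ℂ).continuous
  have h2 : Continuous fun p : Lp ℂ 2 (volume : Measure V) × Lp ℂ 2 (volume : Measure V) =>
      (ContinuousLinearMap.mul ℂ ℂ).holderL volume 2 2 1 p.1 p.2 :=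
    ((ContinuousLinearMap.mul ℂ ℂ).holderL volume 2 2 1).continuous₂
  have h3 := h2.comp ((h1.comp continuous_fst).prodMk (h1.comp continuous_snd))
  refine ((continuous_fourierInv_apply_l1 x).comp h3).congr fun p => ?_
  exact Real.fourierInv_congr_ae (ContinuousLinearMap.coeFn_holder _ _ _) x

theorem continuous_integral_mul_sub_l2 (x : V) :
    Continuous fun p : Lp ℂ 2 (volume : Measure V) × Lp ℂ 2 (volume : Measure V) =>
      ∫ t, p.1 t * p.2 (x - t) := by
  have hmp : MeasurePreserving (fun t : V => x - t) volume volume :=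
    Measure.measurePreserving_sub_left _ x
  have h2 : Continuous fun p : Lp ℂ 2 (volume : Measure V) × Lp ℂ 2 (volume : Measure V) =>
      (ContinuousLinearMap.mul ℂ ℂ).lpPairing volume 2 2 p.1 p.2 :=
    ((ContinuousLinearMap.mul ℂ ℂ).lpPairing volume 2 2).continuous₂
  have h3 := h2.comp (continuous_fst.prodMk
    ((Lp.isometry_compMeasurePreserving (E := ℂ) (p := 2) hmp).continuous.comp continuous_snd))
  refine h3.congr fun p => ?_
  simp only [Function.comp_apply]
  rw [ContinuousLinearMap.lpPairing_eq_integral]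
  refine integral_congr_ae ?_
  filter_upwards [Lp.coeFn_compMeasurePreserving p.2 hmp] with t ht
  rw [ht]
  rfl

/-- The convolution theorem on `L²`, by density from Schwartz functions. -/
theorem integral_mul_sub_eq_fourierInv (f g : Lp ℂ 2 (volume : Measure V)) (x : V) :
    ∫ t, f t * g (x - t) = 𝓕⁻ (fun ξ => 𝓕 f ξ * 𝓕 g ξ : V → ℂ) x := by
  refine DenseRange.induction_on₂ (p := fun f g : Lp ℂ 2 (volume : Measure V) =>
    ∫ t, f t * g (x - t) = 𝓕⁻ (fun ξ => 𝓕 f ξ * 𝓕 g ξ : V → ℂ) x)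
    (SchwartzMap.denseRange_toLpCLM (p := 2) ENNReal.ofNat_ne_top)
    (isClosed_eq (continuous_integral_mul_sub_l2 x) (continuous_fourierInv_mul_fourier_l2 x))
    (fun f g => ?_) f g
  simp only [SchwartzMap.toLpCLM_apply]
  have hmp : MeasurePreserving (fun t : V => x - t) volume volume :=
    Measure.measurePreserving_sub_left _ x
  have hl : ∫ t, f.toLp 2 (volume : Measure V) t * g.toLp 2 (volume : Measure V) (x - t) =
      ∫ t, f t * g (x - t) := by
    refine integral_congr_ae ?_
    have hg := hmp.quasiMeasurePreserving.ae_eq_comp (g.coeFn_toLp 2 (volume : Measure V))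
    filter_upwards [f.coeFn_toLp 2 (volume : Measure V), hg] with t hf hg
    rw [hf]
    exact congrArg _ hg
  have hF : ∀ f : 𝓢(V, ℂ), (𝓕 (f.toLp 2 (volume : Measure V)) : Lp ℂ 2 volume) =ᵐ[volume]
      (𝓕 f : 𝓢(V, ℂ)) := by
    intro f
    rw [SchwartzMap.toLp_fourier_eq]
    exact SchwartzMap.coeFn_toLp _ _ _
  rw [hl, SchwartzMap.convolution_apply_eq_fourierInv]
  refine Real.fourierInv_congr_ae ?_ x
  filter_upwards [hF f, hF g] with ξ hf hg
  rw [hf, hg]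

/-- Uniqueness of the Fourier transform on `L¹`. -/
theorem ae_eq_of_fourierInv_eq {w r : V → ℂ} (hw : Integrable w) (hr : Integrable r)
    (h : 𝓕⁻ w = 𝓕⁻ r) : w =ᵐ[volume] r := by
  have hd : Integrable (w - r) := hw.sub hr
  have hF : 𝓕 (w - r) = 0 := by
    funext ξ
    have h0 : ∀ f : V → ℂ, 𝓕 f ξ = 𝓕⁻ f (-ξ) := fun f => by
      rw [Real.fourierInv_eq_fourier_neg, neg_neg]
    have hi : ∀ {f : V → ℂ}, Integrable f → Integrable fun v => 𝐞 (inner ℝ v (-ξ)) • f v :=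
      fun hf => by
        simpa using (Real.fourierIntegral_convergent_iff ξ).2 hf
    rw [h0, Real.fourierInv_eq]
    simp only [Pi.sub_apply, smul_sub, Pi.zero_apply]
    rw [integral_sub (hi hw) (hi hr), ← Real.fourierInv_eq, ← Real.fourierInv_eq, h, sub_self]
  suffices h0 : ∀ᵐ x, (w - r) x = 0 by
    filter_upwards [h0] with x hx using sub_eq_zero.1 hx
  refine ae_eq_zero_of_integral_contDiff_smul_eq_zero hd.locallyIntegrable fun g hg hgs => ?_
  let φ : 𝓢(V, ℂ) := (hgs.comp_left (g := ((↑) : ℝ → ℂ)) Complex.ofReal_zero).toSchwartzMap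
    (Complex.ofRealCLM.contDiff.comp hg)
  have hφ : ∀ x, g x • (w - r) x = (w - r) x • 𝓕 (𝓕⁻ φ) x := by
    intro x
    rw [FourierTransform.fourier_fourierInv_eq, smul_eq_mul, mul_comm, Complex.real_smul]
    rfl
  have key := VectorFourier.integral_fourierIntegral_smul_eq_flip (L := innerₗ V)
    (μ := volume) (ν := volume) Real.continuous_fourierChar continuous_inner hd
    (𝓕⁻ φ).integrable
  simp only [hφ]
  rw [flip_innerₗ] at key
  refine key.symm.trans ?_
  have : ∀ ξ, VectorFourier.fourierIntegral 𝐞 volume (innerₗ V) (w - r) ξ = 0 := congrFun hF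
  simp [this]

end PlancherelConvolution

/-! ### Convolution square roots are even -/

section SquareRootEven

variable {n : ℕ}

theorem norm_sq_lp_two_eq_integral {V : Type*} [MeasurableSpace V] {m : Measure V}
    (f : Lp ℂ 2 m) : ‖f‖ ^ 2 = ∫ x, ‖f x‖ ^ 2 ∂m := by
  have h : ∀ x, inner ℂ (f x) (f x) = ((‖f x‖ ^ 2 : ℝ) : ℂ) := fun x => by
    rw [inner_self_eq_norm_sq_to_K]
    simp
  rw [norm_sq_eq_re_inner (𝕜 := ℂ) f, L2.inner_def]
  simp only [h]
  rw [integral_complex_ofReal]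
  simp

theorem integrable_mul_sub_of_memLp_two {u : Rn n → ℝ} (hu : MemLp u 2 volume) (x : Rn n) :
    Integrable fun t => u t * u (x - t) :=
  hu.integrable_mul (hu.comp_measurePreserving (Measure.measurePreserving_sub_left _ x))

/-- A square root `u` of a kernel with nonnegative Fourier transform satisfies `‖u‖² = ρ(0)`.
By the convolution theorem `û² = ρ̂ ≥ 0`, so `û² = |û|²`, and Plancherel's theorem applies. -/
theorem integral_sq_eq_integral_mul_neg {ρ : C_c(Rn n, ℝ)} (hρ : IsPosSemidefKernel ρ)
    {u : Rn n → ℝ} (hu : MemLp u 2 volume) (hρu : ⇑ρ = autoconvolution u) :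
    ∫ t, u t ^ 2 = ∫ t, u t * u (-t) := by
  have hU : MemLp (fun t => (u t : ℂ)) 2 (volume : Measure (Rn n)) := hu.ofReal
  set U : Lp ℂ 2 (volume : Measure (Rn n)) := hU.toLp with hUdef
  have hUae : U =ᵐ[volume] fun t => (u t : ℂ) := hU.coeFn_toLp
  set r : Rn n → ℂ := 𝓕 (fun x : Rn n => (ρ x : ℂ)) with hr
  set w : Rn n → ℂ := fun ξ => 𝓕 U ξ * 𝓕 U ξ with hw
  have hwint : Integrable w := (Lp.memLp (𝓕 U)).integrable_mul (Lp.memLp (𝓕 U))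
  have hρ' : ∀ x, ρ x = ∫ t, u t * u (x - t) := fun x => by
    rw [hρu]
    rfl
  have hwinv : 𝓕⁻ w = 𝓕⁻ r := by
    rw [hr, fourierInv_fourier_kernel hρ]
    funext x
    rw [hw, ← integral_mul_sub_eq_fourierInv U U x, hρ', ← integral_complex_ofReal]
    refine integral_congr_ae ?_
    have h2 := (Measure.measurePreserving_sub_left (volume : Measure (Rn n))
      x).quasiMeasurePreserving.ae_eq_comp hUae
    filter_upwards [hUae, h2] with t h1 h2
    rw [h1, show U (x - t) = (u (x - t) : ℂ) from h2, Complex.ofReal_mul]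
  have hwr : w =ᵐ[volume] r :=
    ae_eq_of_fourierInv_eq hwint (integrable_fourier_kernel hρ) hwinv
  have hnorm : ∫ ξ, ‖𝓕 U ξ‖ ^ 2 = ρ 0 := by
    have h1 : (ρ 0 : ℂ) = ∫ ξ, r ξ := by
      rw [← congrFun (fourierInv_fourier_kernel hρ) 0, Real.fourierInv_eq]
      simp [hr]
    rw [← Complex.ofReal_inj, h1, ← integral_complex_ofReal]
    refine integral_congr_ae ?_
    filter_upwards [hwr] with ξ hξ
    have hre : r ξ = ((r ξ).re : ℂ) := Complex.ext (by simp) (by simpa using (hρ ξ).1)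
    rw [hre]
    congr 1
    rw [sq, ← norm_mul]
    change ‖w ξ‖ = _
    rw [hξ, hre, Complex.norm_real, Complex.ofReal_re, Real.norm_of_nonneg (hρ ξ).2]
  calc ∫ t, u t ^ 2 = ∫ t, ‖U t‖ ^ 2 := by
        refine integral_congr_ae ?_
        filter_upwards [hUae] with t ht
        rw [ht, Complex.norm_real, Real.norm_eq_abs, sq_abs]
    _ = ∫ ξ, ‖𝓕 U ξ‖ ^ 2 := by
        rw [← norm_sq_lp_two_eq_integral, ← norm_sq_lp_two_eq_integral, Lp.norm_fourier_eq]
    _ = ρ 0 := hnorm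
    _ = _ := by simp [hρ']

/-- Equality in Cauchy–Schwarz for `u` and its reflection: a continuous convolution square root is
an even function. -/
theorem even_of_autoconvolution_eq {ρ : C_c(Rn n, ℝ)} (hρ : IsPosSemidefKernel ρ)
    {u : Rn n → ℝ} (huc : Continuous u) (hu : MemLp u 2 volume) (hρu : ⇑ρ = autoconvolution u)
    (x : Rn n) : u (-x) = u x := by
  have h1 : Integrable fun t => u t ^ 2 := hu.integrable_sq
  have h2 : Integrable fun t => u (-t) ^ 2 := h1.comp_neg
  have h3 : Integrable fun t => u t * u (-t) := by
    simpa using integrable_mul_sub_of_memLp_two hu 0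
  have hzero : ∫ t, (u (-t) - u t) ^ 2 = 0 := by
    have : ∀ t, (u (-t) - u t) ^ 2 = u (-t) ^ 2 + u t ^ 2 - 2 * (u t * u (-t)) := fun t => by ring
    simp only [this]
    have h21 : Integrable fun t => u (-t) ^ 2 + u t ^ 2 := h2.add h1
    rw [integral_sub h21 (h3.const_mul 2), integral_add h2 h1, integral_const_mul,
      integral_neg_eq_self (fun t => u t ^ 2) volume, integral_sq_eq_integral_mul_neg hρ hu hρu]
    ring
  have hint : Integrable fun t => (u (-t) - u t) ^ 2 := by
    refine ((h2.add h1).sub (h3.const_mul 2)).congr (Eventually.of_forall fun t => ?_)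
    simp only [Pi.add_apply, Pi.sub_apply]
    ring
  have hae := (integral_eq_zero_iff_of_nonneg (fun t => sq_nonneg _) hint).1 hzero
  have hcont : Continuous fun t => (u (-t) - u t) ^ 2 := by fun_prop
  have := congrFun ((Continuous.ae_eq_iff_eq volume hcont continuous_zero).1 hae) x
  exact sub_eq_zero.1 (pow_eq_zero_iff two_ne_zero |>.1 this)

end SquareRootEven

/-! ### Convergence of the energy implies weak-* convergence -/

section SeminormToWeakStar

variable {n : ℕ} {Ω : Compacts (Rn n)}

/-- The function `x ↦ u (y - x)` on `Ω`. -/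
noncomputable def vanishingTranslate (Ω : Compacts (Rn n)) (u : C₀(Rn n, ℝ)) (y : Rn n) :
    C(Ω, ℝ) where
  toFun x := u (y - x)
  continuous_toFun := u.continuous.comp (by fun_prop)

/-- **Energy as an `L²` norm**: `⟨ρ * μ, μ⟩ = ‖u * μ‖²` for an even square root `u` of `ρ`. -/
theorem dualPairing_convolutionOperator_eq_integral_sq {ρ : C_c(Rn n, ℝ)} {u : C₀(Rn n, ℝ)}
    (hu : MemLp u 2 volume) (heven : ∀ x, u (-x) = u x) (hρu : ⇑ρ = autoconvolution u)
    (μ : RadonMeasure Ω) :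
    Integrable (fun s => dualPairing (vanishingTranslate Ω u s) μ ^ 2) ∧
      dualPairing (convolutionOperator Ω ρ μ) μ =
        ∫ s, dualPairing (vanishingTranslate Ω u s) μ ^ 2 := by
  obtain ⟨h, hm, hh, hμ⟩ := exists_sign_density μ
  set g : Rn n → Ω → ℂ := fun s x => (u (s - x) : ℂ) with hg
  have hgc : Continuous (Function.uncurry g) :=
    Complex.continuous_ofReal.comp (u.continuous.comp
      (by fun_prop : Continuous fun p : Rn n × Ω => p.1 - (p.2 : Rn n)))
  have hgn : ∀ s x, ‖g s x‖ ^ 2 = u (s - x) ^ 2 := fun s x => by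
    rw [Complex.norm_real, Real.norm_eq_abs, sq_abs]
  have hK : ∀ x y : Ω, (ρ ((x : Rn n) - y) : ℂ) = ∫ s, g s x * (starRingEnd ℂ) (g s y) := by
    intro x y
    have h1 : ρ ((x : Rn n) - y) = ∫ t, u t * u ((x : Rn n) - y - t) := by
      rw [hρu]
      rfl
    -- substitute `t = x - s` in the autoconvolution, then use that `u` is even
    rw [h1, ← integral_sub_left_eq_self _ volume (x : Rn n), ← integral_complex_ofReal]
    congr 1 with s
    simp only [hg, Complex.conj_ofReal, Complex.ofReal_mul]
    rw [← heven (x - s), neg_sub]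
    congr 3
    abel
  have hfeat : ∀ s, ‖∫ x, g s x * h x ∂μ.totalVariation‖ ^ 2 =
      dualPairing (vanishingTranslate Ω u s) μ ^ 2 := by
    intro s
    have : ∫ x, g s x * h x ∂μ.totalVariation =
        (dualPairing (vanishingTranslate Ω u s) μ : ℂ) := by
      rw [hμ, ← integral_complex_ofReal]
      congr 1 with x
      rw [Complex.ofReal_mul]
      rfl
    rw [this, Complex.norm_real, Real.norm_eq_abs, sq_abs]
  have main := integral_integral_kernel_eq_integral_sq (m := μ.totalVariation)
    (ν := (volume : Measure (Rn n))) (g := g) (C := ∫ t, u t ^ 2) hgc.measurable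
    (fun x => by simpa only [hgn] using hu.integrable_sq.comp_sub_right (x : Rn n))
    (fun x => by
      simp only [hgn]
      exact (integral_sub_right_eq_self (fun t => u t ^ 2) (x : Rn n)).le) hm hh hK
  simp only [hfeat] at main
  rw [dualPairing_convolutionOperator_eq ρ hμ hμ]
  exact main

/-- Functions with a common modulus of continuity that tend to zero in `L²` tend to zero
pointwise. -/
theorem tendsto_zero_of_tendsto_integral_sq {f : ℕ → Rn n → ℝ}
    (hint : ∀ k, Integrable fun s => f k s ^ 2)
    (hlim : Tendsto (fun k => ∫ s, f k s ^ 2) atTop (𝓝 0)) (y : Rn n)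
    (hequi : ∀ ε > 0, ∃ δ > 0, ∀ k, ∀ s ∈ Metric.ball y δ, |f k s - f k y| ≤ ε) :
    Tendsto (fun k => f k y) atTop (𝓝 0) := by
  rw [Metric.tendsto_atTop']
  intro ε hε
  -- a value `|f k y| ≥ ε` forces `|f k| ≥ ε / 2` on a ball whose radius does not depend on `k`
  obtain ⟨δ, hδ, hf⟩ := hequi (ε / 2) (by positivity)
  have hvol : 0 < volume.real (Metric.ball y δ) :=
    ENNReal.toReal_pos (Metric.measure_ball_pos volume y hδ).ne' measure_ball_lt_top.ne
  have hev := hlim.eventually_lt_const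
    (show (0 : ℝ) < (ε / 2) ^ 2 * volume.real (Metric.ball y δ) by positivity)
  obtain ⟨N, hN⟩ := eventually_atTop.1 hev
  refine ⟨N, fun k hk => ?_⟩
  by_contra! hcon
  rw [Real.dist_eq, sub_zero] at hcon
  refine (hN k hk.le).not_ge ?_
  calc (ε / 2) ^ 2 * volume.real (Metric.ball y δ)
      = ∫ _ in Metric.ball y δ, (ε / 2) ^ 2 := by
        rw [setIntegral_const, smul_eq_mul, mul_comm]
    _ ≤ ∫ s in Metric.ball y δ, f k s ^ 2 := by
        refine setIntegral_mono_on (integrableOn_const measure_ball_lt_top.ne)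
          (hint k).integrableOn measurableSet_ball fun s hs => ?_
        have h1 := hf k s hs
        have h2 : |f k y| ≤ |f k s| + |f k s - f k y| := by
          have := abs_sub_abs_le_abs_sub (f k y) (f k s)
          rw [abs_sub_comm] at this
          linarith
        rw [← sq_abs (f k s)]
        gcongr
        linarith
    _ ≤ ∫ s, f k s ^ 2 :=
        setIntegral_le_integral (hint k) (Eventually.of_forall fun s => sq_nonneg _)

/-- The convolutions `u * (μₖ - μ)` are uniformly equicontinuous and tend to zero in `L²`, hence
pointwise; their values at `y ∈ Ω` are the pairings with the translates of the even function `u`,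
whose span is dense. -/
theorem weakStarTendsto_of_tendsto_opSeminorm {ρ : C_c(Rn n, ℝ)} (hρ : IsPosSemidefKernel ρ)
    {u : C₀(Rn n, ℝ)} (hu : MemLp u 2 volume) (hρu : ⇑ρ = autoconvolution u)
    (hfund : IsFundamental (translates Ω u)) {μs : ℕ → RadonMeasure Ω} {μ : RadonMeasure Ω}
    (hbdd : ∃ M : ℝ, ∀ k, radonNorm (μs k) ≤ M)
    (h : Tendsto (fun k => opSeminorm (convolutionOperator Ω ρ) (μs k - μ)) atTop (𝓝 0)) :
    WeakStarTendsto μs μ := by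
  have heven : ∀ x, u (-x) = u x := even_of_autoconvolution_eq hρ (map_continuous u) hu hρu
  obtain ⟨M, hM⟩ : ∃ M : ℝ, ∀ k, ‖pairingCLM (μs k - μ)‖ ≤ M := by
    obtain ⟨M, hM⟩ := hbdd
    exact ⟨M + radonNorm μ, fun k => (norm_pairingCLM_le _).trans
      ((radonNorm_sub_le _ _).trans (by gcongr; exact hM k))⟩
  have hM0 : 0 ≤ M := (norm_nonneg (pairingCLM (μs 0 - μ))).trans (hM 0)
  have hsq := fun k => dualPairing_convolutionOperator_eq_integral_sq hu heven hρu (μs k - μ)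
  have hlim : Tendsto (fun k => ∫ s, dualPairing (vanishingTranslate Ω u s) (μs k - μ) ^ 2)
      atTop (𝓝 0) := by
    have h2 := h.pow 2
    rw [zero_pow two_ne_zero] at h2
    refine h2.congr fun k => ?_
    rw [opSeminorm, (hsq k).2, Real.sq_sqrt (integral_nonneg fun _ => sq_nonneg _)]
  have huc : UniformContinuous u := ZeroAtInftyContinuousMap.uniformContinuous u
  have htrans : ∀ y : Rn n,
      Tendsto (fun k => dualPairing (vanishingTranslate Ω u y) (μs k - μ)) atTop (𝓝 0) := by
    intro y
    refine tendsto_zero_of_tendsto_integral_sq (fun k => (hsq k).1) hlim y fun ε hε => ?_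
    obtain ⟨δ, hδ, hud⟩ := Metric.uniformContinuous_iff.1 huc (ε / (M + 1)) (by positivity)
    refine ⟨δ, hδ, fun k s hs => ?_⟩
    rw [← pairingCLM_apply, ← pairingCLM_apply, ← map_sub, ← Real.norm_eq_abs]
    refine ((pairingCLM (μs k - μ)).le_of_opNorm_le (hM k) _).trans ?_
    have : ‖vanishingTranslate Ω u s - vanishingTranslate Ω u y‖ ≤ ε / (M + 1) := by
      refine (ContinuousMap.norm_le _ (by positivity)).2 fun x => ?_
      have hx : dist (s - (x : Rn n)) (y - x) < δ := by simpa using hs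
      exact (hud hx).le
    calc M * ‖vanishingTranslate Ω u s - vanishingTranslate Ω u y‖ ≤ (M + 1) * (ε / (M + 1)) := by
          gcongr; linarith
      _ = ε := by field_simp
  rw [weakStarTendsto_iff_sub]
  have hspan : ∀ ψ ∈ Submodule.span ℝ (translates Ω u),
      Tendsto (fun k => pairingCLM (μs k - μ) ψ) atTop (𝓝 0) := by
    intro ψ hψ
    induction hψ using Submodule.span_induction with
    | mem ψ hψ =>
      obtain ⟨y, hy⟩ := hψ
      have : ψ = vanishingTranslate Ω u y := by
        ext x
        rw [hy, ← heven, neg_sub]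
        rfl
      rw [this]
      exact htrans y
    | zero => simpa only [map_zero] using tendsto_const_nhds
    | add ψ χ _ _ h1 h2 => simpa only [map_add, add_zero] using h1.add h2
    | smul c ψ _ h1 => simpa only [map_smul, smul_eq_mul, mul_zero] using h1.const_mul c
  intro φ
  rw [Metric.tendsto_atTop']
  intro ε hε
  obtain ⟨ψ, hψ, hφψ⟩ := Metric.mem_closure_iff.1 (hfund φ) (ε / (2 * (M + 1))) (by positivity)
  obtain ⟨N, hN⟩ := Metric.tendsto_atTop'.1 (hspan ψ hψ) (ε / 2) (by positivity)
  refine ⟨N, fun k hk => ?_⟩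
  have h1 := hN k hk
  rw [dist_zero_right] at h1 ⊢
  have h2 : ‖pairingCLM (μs k - μ) (φ - ψ)‖ ≤ ε / 2 := by
    refine ((pairingCLM (μs k - μ)).le_of_opNorm_le (hM k) _).trans ?_
    rw [← dist_eq_norm]
    calc M * dist φ ψ ≤ (M + 1) * (ε / (2 * (M + 1))) := by gcongr; linarith
      _ = ε / 2 := by field_simp
  calc ‖pairingCLM (μs k - μ) φ‖
      = ‖pairingCLM (μs k - μ) (φ - ψ) + pairingCLM (μs k - μ) ψ‖ := by
        rw [← map_add, sub_add_cancel]
    _ ≤ ‖pairingCLM (μs k - μ) (φ - ψ)‖ + ‖pairingCLM (μs k - μ) ψ‖ := norm_add_le _ _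
    _ < ε := by linarith

end SeminormToWeakStar

theorem mainTheorem1 {n : ℕ} (Ω : Compacts (Rn n)) (ρ : C_c(Rn n, ℝ)) (hρ_ne : ρ ≠ 0)
    (hρ_symm : IsSymmetricKernel ρ) (hρ_pos : IsPosSemidefKernel ρ) :
    -- (i)
    (IsPreSelfAdjoint (convolutionOperator Ω ρ) ∧ IsPrePosSemidef (convolutionOperator Ω ρ)) ∧
    -- (ii)
    IsPrePosDefOn (convolutionOperator Ω ρ) (discreteMeasures Ω) ∧
    -- `u` is the convolution square root of `ρ`
    (∀ u : C₀(Rn n, ℝ), MemLp u 2 volume → (⇑ρ = autoconvolution u) →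
      -- (iii)
      (HasCompactSupport u →
        ∀ (μs : ℕ → RadonMeasure Ω) (μ : RadonMeasure Ω), WeakStarTendsto μs μ →
          Tendsto (fun k => opSeminorm (convolutionOperator Ω ρ) (μs k - μ)) atTop (𝓝 0)) ∧
      -- (iv)
      (IsFundamental (translates Ω u) →
        ∀ (μs : ℕ → RadonMeasure Ω) (μ : RadonMeasure Ω), (∃ M : ℝ, ∀ k, radonNorm (μs k) ≤ M) →
          Tendsto (fun k => opSeminorm (convolutionOperator Ω ρ) (μs k - μ)) atTop (𝓝 0) →
          WeakStarTendsto μs μ)) :=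
  ⟨⟨isPreSelfAdjoint_convolutionOperator hρ_symm, isPrePosSemidef_convolutionOperator hρ_pos⟩,
    isPrePosDefOn_discreteMeasures hρ_ne hρ_pos, fun _ hu hρu =>
      ⟨fun _ _ _ hμ => tendsto_opSeminorm_of_weakStarTendsto ρ hμ,
        fun hfund _ _ hbdd h => weakStarTendsto_of_tendsto_opSeminorm hρ_pos hu hρu hfund hbdd h⟩⟩
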